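/- Let $n\ge 0$ be an integer and let $\omega=\sum_{i=1}^n dx_i\wedge dy_i$ be the standard symplectic form on $\mathbb{R}^{2n}=\mathbb{R}^n\oplus\mathbb{R}^n$. Let $$\mathrm{Sp}(n)=\{\psi\in\mathrm{GL}(2n,\mathbb{R})\mid \omega(\psi v,\psi w)=\omega(v,w)\ \text{for all } v,w\in\mathbb{R}^{2n}\}$$ be the linear symplectic group, let $R=\begin{pmatrix}\mathbb{1}&0\\0&-\mathbb{1}\end{pmatrix}$ with respect to the splitting $\mathbb{R}^n\oplus\mathbb{R}^n$, and let $$\mathrm{Sp}^R(n)=\{\psi\in\mathrm{Sp}(n)\mid \psi=R\psi^{-1}R\}.$$ Then every element of $\mathrm{Sp}(n)$ is conjugate in $\mathrm{Sp}(n)$ to an element of $\mathrm{Sp}^R(n)$: for every $\phi\in\mathrm{Sp}(n)$ there exists $\psi\in\mathrm{Sp}(n)$ with $\psi\phi\psi^{-1}\in\mathrm{Sp}^R(n)$. -/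

import Mathlib

open Matrix

/-- The standard symplectic form `ω = ∑ i, dx_i ∧ dy_i` on `ℝ²ⁿ = ℝⁿ ⊕ ℝⁿ`, where `x` is the first
and `y` the second component. -/
def stdSymplecticForm (n : ℕ) (v w : Fin n ⊕ Fin n → ℝ) : ℝ :=
  ∑ i, (v (Sum.inl i) * w (Sum.inr i) - v (Sum.inr i) * w (Sum.inl i))

theorem stdSymplecticForm_eq (n : ℕ) (v w : Fin n ⊕ Fin n → ℝ) :
    stdSymplecticForm n v w = -(v ⬝ᵥ (J (Fin n) ℝ *ᵥ w)) := by
  obtain ⟨v₁, v₂, rfl⟩ : ∃ v₁ v₂ : Fin n → ℝ, v = Sum.elim v₁ v₂ :=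
    ⟨v ∘ Sum.inl, v ∘ Sum.inr, (Sum.elim_comp_inl_inr v).symm⟩
  obtain ⟨w₁, w₂, rfl⟩ : ∃ w₁ w₂ : Fin n → ℝ, w = Sum.elim w₁ w₂ :=
    ⟨w ∘ Sum.inl, w ∘ Sum.inr, (Sum.elim_comp_inl_inr w).symm⟩
  simp [stdSymplecticForm, J, fromBlocks_mulVec, dotProduct, Finset.sum_sub_distrib, Matrix.neg_mulVec]
  ring

/-- Mathlib's symplectic group consists exactly of the matrices that preserve the standard
symplectic form. -/
theorem mem_symplecticGroup_iff_form (n : ℕ) (A : Matrix (Fin n ⊕ Fin n) (Fin n ⊕ Fin n) ℝ) :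
    A ∈ symplecticGroup (Fin n) ℝ ↔
      ∀ v w, stdSymplecticForm n (A *ᵥ v) (A *ᵥ w) = stdSymplecticForm n v w := by
  have key : ∀ v w, (A *ᵥ v) ⬝ᵥ (J (Fin n) ℝ *ᵥ (A *ᵥ w)) = v ⬝ᵥ ((Aᵀ * J (Fin n) ℝ * A) *ᵥ w) := by
    intro v w
    rw [← mulVec_mulVec, ← mulVec_mulVec, dotProduct_mulVec v, vecMul_transpose]
  rw [SymplecticGroup.mem_iff']
  simp only [stdSymplecticForm_eq, key, neg_inj]
  constructor
  · intro h v w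
    rw [h]
  · intro h
    ext i j
    simpa using h (Pi.single i 1) (Pi.single j 1)

/-- The standard anti-symplectic involution `R = diag(1, -1)` with respect to the Lagrangian
splitting `ℝ²ⁿ = ℝⁿ ⊕ ℝⁿ`. -/
def antiSymplecticR (n : ℕ) : Matrix (Fin n ⊕ Fin n) (Fin n ⊕ Fin n) ℝ :=
  fromBlocks 1 0 0 (-1)

/-- `Sp^R(n) = {ψ ∈ Sp(n) | ψ = R ψ⁻¹ R}`. -/
def SpR (n : ℕ) : Set (symplecticGroup (Fin n) ℝ) :=
  {ψ | (ψ : Matrix (Fin n ⊕ Fin n) (Fin n ⊕ Fin n) ℝ) =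
    antiSymplecticR n * ((ψ⁻¹ : symplecticGroup (Fin n) ℝ) :
      Matrix (Fin n ⊕ Fin n) (Fin n ⊕ Fin n) ℝ) * antiSymplecticR n}

open Polynomial

/-- `A` is self-adjoint and `K` skew-adjoint for the alternating form `ω`, they commute, and
`K ^ 2 = d(A)`. -/
structure IsSkewRoot {F V : Type*} [Field F] [AddCommGroup V] [Module F V]
    (ω : LinearMap.BilinForm F V) (A K : Module.End F V) (d : F[X]) : Prop where
  alt : ω.IsAlt
  selfAdj : ∀ x y, ω (A x) y = ω x (A y)
  skewAdj : ∀ x y, ω (K x) y = -ω x (K y)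
  comm : ∀ x, K (A x) = A (K x)
  sq : ∀ x, K (K x) = aeval A d x

/-- `S` is an involution that reverses the sign of `ω`, commutes with `A` and anticommutes
with `K`. -/
structure IsReversor {F V : Type*} [Field F] [AddCommGroup V] [Module F V]
    (ω : LinearMap.BilinForm F V) (A K S : Module.End F V) : Prop where
  invol : ∀ x, S (S x) = x
  anti : ∀ x y, ω (S x) (S y) = -ω x y
  comm : ∀ x, S (A x) = A (S x)
  anticomm : ∀ x, S (K x) = -K (S x)

section Bezout

variable {F : Type*} [Field F] {r : F[X]}

theorem exists_mul_add_eq_pow_of_not_pow_dvd (hr : Irreducible r) {k : ℕ} {f : F[X]}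
    (hf : ¬ r ^ (k + 1) ∣ f) : ∃ g h, f * g + r ^ (k + 1) * h = r ^ k := by
  classical
  have hg : gcd f (r ^ (k + 1)) ∣ r ^ (k + 1) := gcd_dvd_right _ _
  obtain ⟨i, hi, hass⟩ := (dvd_prime_pow hr.prime _).1 hg
  have hik : i ≤ k := by
    by_contra h
    have : i = k + 1 := by omega
    subst this
    exact hf (hass.symm.dvd.trans (gcd_dvd_left _ _))
  obtain ⟨a, b, hab⟩ := exists_gcd_eq_mul_add_mul f (r ^ (k + 1))
  obtain ⟨q, hq⟩ := hass.dvd.trans (pow_dvd_pow r hik)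
  exact ⟨a * q, b * q, by rw [hq, hab]; ring⟩

/-- The coupled divisibility conditions that describe the radical of a pair of cyclic modules. -/
theorem pow_dvd_of_coupled (hr : Irreducible r) {k : ℕ} {d : F[X]} (hd : Squarefree d)
    (hrd : r ∣ d) (μ α β : F[X] →ₗ[F] F) (hμ : ∀ f, (∀ z, μ (f * z) = 0) → r ^ (k + 1) ∣ f)
    (hα : ∀ z, r ^ k ∣ z → α z = 0) (hβ : ∀ z, r ^ k ∣ z → β z = 0) {a b : F[X]}
    (h₁ : ∀ z, μ (a * z) = β (b * z)) (h₂ : ∀ z, μ (b * d * z) = α (a * z)) :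
    r ^ (k + 1) ∣ a ∧ r ^ k ∣ b := by
  obtain ⟨e, rfl⟩ := hrd
  have hre : ¬ r ∣ e := by
    rintro ⟨e', rfl⟩
    exact hr.not_isUnit (hd r ⟨e', by ring⟩)
  have hr0 : ∀ n, r ^ n ≠ 0 := fun n => pow_ne_zero n hr.ne_zero
  have step : ∀ j, j ≤ k → r ^ j ∣ b → r ^ (j + 1) ∣ a := by
    rintro j hj ⟨b', rfl⟩
    obtain ⟨i, rfl⟩ := Nat.exists_eq_add_of_le hj
    have : r ^ (j + i + 1) ∣ a * r ^ i := hμ _ fun z => by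
      rw [mul_assoc, h₁]
      exact hβ _ ⟨b' * z, by ring⟩
    rw [show j + i + 1 = (j + 1) + i by ring, pow_add] at this
    exact (mul_dvd_mul_iff_right (hr0 i)).1 this
  have key : ∀ j, j ≤ k → r ^ j ∣ b := by
    intro j
    induction j with
    | zero => simp
    | succ j ih =>
      intro hj
      obtain ⟨a', rfl⟩ := step j (by omega) (ih (by omega))
      obtain ⟨i, rfl⟩ := Nat.exists_eq_add_of_le hj
      have : r ^ (j + 1 + i + 1) ∣ b * (r * e) * r ^ i := hμ _ fun z => by
        rw [mul_assoc, h₂]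
        exact hα _ ⟨a' * z, by ring⟩
      rw [show j + 1 + i + 1 = (j + 1) + (i + 1) by ring, pow_add,
        show b * (r * e) * r ^ i = (b * e) * r ^ (i + 1) by ring] at this
      exact hr.prime.pow_dvd_of_dvd_mul_right _ hre ((mul_dvd_mul_iff_right (hr0 (i + 1))).1 this)
  exact ⟨step k le_rfl (key k le_rfl), key k le_rfl⟩

end Bezout

section Cyclic

variable {F V : Type*} [Field F] [AddCommGroup V] [Module F V]
  {ω : LinearMap.BilinForm F V} {A K : Module.End F V} {d : F[X]}

/-- The map `(p, q) ↦ p(A) x + q(A) K x`. -/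
noncomputable def cyclicMap (A K : Module.End F V) (x : V) : F[X] × F[X] →ₗ[F] V :=
  ((LinearMap.applyₗ x).comp (aeval A).toLinearMap).coprod
    ((LinearMap.applyₗ (K x)).comp (aeval A).toLinearMap)

theorem cyclicMap_apply (x : V) (m : F[X] × F[X]) :
    cyclicMap A K x m = aeval A m.1 x + aeval A m.2 (K x) := rfl

theorem aeval_mul_apply (p q : F[X]) (x : V) :
    aeval A (p * q) x = aeval A p (aeval A q x) := by
  rw [map_mul, Module.End.mul_apply]

theorem aeval_X_mul_apply (p : F[X]) (x : V) : aeval A (X * p) x = A (aeval A p x) := by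
  rw [aeval_mul_apply, aeval_X]

theorem aeval_apply_eq_zero_of_dvd {p q : F[X]} (h : p ∣ q) {x : V} (hx : aeval A p x = 0) :
    aeval A q x = 0 := by
  obtain ⟨c, rfl⟩ := h
  rw [mul_comm, aeval_mul_apply, hx, map_zero]

/-- The functional `p ↦ ω(p(A) x, y)`. -/
noncomputable def formFunctional (ω : LinearMap.BilinForm F V) (A : Module.End F V) (x y : V) :
    F[X] →ₗ[F] F :=
  ((ω.flip y).comp (LinearMap.applyₗ x)).comp (aeval A).toLinearMap

theorem formFunctional_apply (x y : V) (p : F[X]) :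
    formFunctional ω A x y p = ω (aeval A p x) y := rfl

theorem map_A_cyclicMap (x : V) (m : F[X] × F[X]) :
    A (cyclicMap A K x m) = cyclicMap A K x (X * m.1, X * m.2) := by
  simp only [cyclicMap_apply, aeval_X_mul_apply, map_add]

/-- A functional `p ↦ ω(p(A) x, y)` on `F[X]/(r ^ (k + 1))` that does not vanish on the socle has
trivial radical. -/
theorem pow_dvd_of_form_eq_zero {r : F[X]} (hr : Irreducible r) {k : ℕ} {x y : V}
    (hx : aeval A (r ^ (k + 1)) x = 0) (hxy : ω (aeval A (r ^ k) x) y ≠ 0) {f : F[X]}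
    (hf : ∀ z, ω (aeval A (f * z) x) y = 0) : r ^ (k + 1) ∣ f := by
  by_contra hn
  obtain ⟨g, q, hgq⟩ := exists_mul_add_eq_pow_of_not_pow_dvd hr hn
  apply hxy
  rw [← hgq, map_add, LinearMap.add_apply, map_add, LinearMap.add_apply, hf,
    aeval_apply_eq_zero_of_dvd (dvd_mul_right _ q) hx, map_zero, LinearMap.zero_apply, add_zero]

namespace IsSkewRoot

variable (h : IsSkewRoot ω A K d)
include h

theorem aeval_selfAdj (p : F[X]) (x y : V) : ω (aeval A p x) y = ω x (aeval A p y) := by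
  induction p using Polynomial.induction_on' with
  | add p q hp hq => simp [hp, hq]
  | monomial n c =>
    simp only [aeval_monomial, Module.End.mul_apply, Module.algebraMap_end_apply, map_smul,
      LinearMap.smul_apply]
    congr 1
    induction n generalizing y with
    | zero => simp
    | succ n ih => rw [pow_succ', Module.End.mul_apply, h.selfAdj, ih, ← Module.End.mul_apply,
        ← pow_succ, pow_succ']

theorem comm_aeval (p : F[X]) (x : V) : K (aeval A p x) = aeval A p (K x) := by
  have : Commute K (aeval A p) := by
    refine (Algebra.commute_of_mem_adjoin_singleton_of_commute (R := F)
      (aeval_mem_adjoin_singleton F A) ?_)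
    exact LinearMap.ext h.comm
  exact LinearMap.congr_fun this x

theorem form_aeval_self [NeZero (2 : F)] (p : F[X]) (x : V) : ω (aeval A p x) x = 0 := by
  have h1 := h.alt.neg_eq (aeval A p x) x
  rw [← h.aeval_selfAdj] at h1
  have : (2 : F) * ω (aeval A p x) x = 0 := by linear_combination -h1
  simpa [NeZero.ne] using this

theorem form_aeval_swap (p : F[X]) (x y : V) : ω (aeval A p x) y = -ω (aeval A p y) x := by
  rw [h.aeval_selfAdj, h.alt.neg_eq]

theorem form_aeval_skew_swap (p : F[X]) (x y : V) :
    ω (aeval A p (K x)) y = ω (aeval A p (K y)) x := by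
  rw [h.aeval_selfAdj, h.skewAdj, h.comm_aeval, h.alt.neg_eq]

theorem form_cyclicMap (x y : V) (m n : F[X] × F[X]) :
    ω (cyclicMap A K x m) (cyclicMap A K y n) =
      ω (aeval A (m.1 * n.1 - m.2 * n.2 * d) x) y +
        ω (aeval A (m.2 * n.1 - m.1 * n.2) (K x)) y := by
  have e1 : ∀ (p q : F[X]) (x y : V), ω (aeval A p x) (aeval A q y) = ω (aeval A (p * q) x) y := by
    intro p q x y
    rw [← h.aeval_selfAdj, ← aeval_mul_apply, mul_comm]
  have e2 : ∀ (p : F[X]) (x y : V), ω (aeval A p x) (K y) = -ω (aeval A p (K x)) y := by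
    intro p x y
    rw [← h.comm_aeval, h.skewAdj, neg_neg]
  simp only [cyclicMap_apply, map_add, LinearMap.add_apply, e1, e2, map_sub, LinearMap.sub_apply,
    h.sq, aeval_mul_apply _ d]
  ring

theorem map_K_cyclicMap (x : V) (m : F[X] × F[X]) :
    K (cyclicMap A K x m) = cyclicMap A K x (m.2 * d, m.1) := by
  simp only [cyclicMap_apply, h.comm_aeval, map_add, aeval_mul_apply, h.sq]
  rw [add_comm]

end IsSkewRoot

end Cyclic

section Extension

variable {F V M : Type*} [Field F] [AddCommGroup V] [Module F V] [AddCommGroup M] [Module F M]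
  {ω : LinearMap.BilinForm F V} {A K : Module.End F V} {d : F[X]}

/-- A linear map `π` onto a nondegenerate subspace of `V` stable under `A` and `K`, together with
an involution `σ` of the source that descends to a reversor of the image. -/
structure IsReversorCover (ω : LinearMap.BilinForm F V) (A K : Module.End F V) (π : M →ₗ[F] V)
    (σ : M →ₗ[F] M) : Prop where
  invol : ∀ m, σ (σ m) = m
  map_A : ∀ m, ∃ m', A (π m) = π m' ∧ A (π (σ m)) = π (σ m')
  map_K : ∀ m, ∃ m', K (π m) = π m' ∧ K (π (σ m)) = -π (σ m')
  anti : ∀ m n, ω (π (σ m)) (π (σ n)) = -ω (π m) (π n)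
  radical : ∀ m, (∀ n, ω (π m) (π n) = 0) → π m = 0

theorem coe_aeval_restrict {W : Submodule F V} (hW : ∀ x ∈ W, A x ∈ W) (p : F[X]) (x : W) :
    (aeval (A.restrict hW) p x : V) = aeval A p x := by
  induction p using Polynomial.induction_on' with
  | add p q hp hq => simp [hp, hq]
  | monomial n c =>
    simp [aeval_monomial, Module.algebraMap_end_apply, Module.End.pow_restrict n]

theorem IsSkewRoot.restrict (h : IsSkewRoot ω A K d) {W : Submodule F V}
    (hA : ∀ x ∈ W, A x ∈ W) (hK : ∀ x ∈ W, K x ∈ W) :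
    IsSkewRoot (ω.restrict W) (A.restrict hA) (K.restrict hK) d where
  alt x := h.alt x
  selfAdj x y := h.selfAdj x y
  skewAdj x y := h.skewAdj x y
  comm x := Subtype.ext (h.comm x)
  sq x := Subtype.ext <| by
    rw [coe_aeval_restrict]
    exact h.sq x

theorem IsReversorCover.disjoint_orthogonal {π : M →ₗ[F] V} {σ : M →ₗ[F] M} (hω : ω.IsAlt)
    (hc : IsReversorCover ω A K π σ) : Disjoint π.range (ω.orthogonal π.range) := by
  rw [Submodule.disjoint_def]
  rintro _ ⟨m, rfl⟩ hm
  refine hc.radical m fun n => ?_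
  rw [← hω.neg_eq, hm _ ⟨n, rfl⟩, neg_zero]

theorem IsSkewRoot.map_A_orthogonal (h : IsSkewRoot ω A K d) {π : M →ₗ[F] V} {σ : M →ₗ[F] M}
    (hc : IsReversorCover ω A K π σ) :
    ∀ x ∈ ω.orthogonal π.range, A x ∈ ω.orthogonal π.range := by
  rintro x hx _ ⟨m, rfl⟩
  obtain ⟨m', hm', -⟩ := hc.map_A m
  change ω (π m) _ = 0
  rw [← h.selfAdj, hm']
  exact hx _ ⟨m', rfl⟩

theorem IsSkewRoot.map_K_orthogonal (h : IsSkewRoot ω A K d) {π : M →ₗ[F] V} {σ : M →ₗ[F] M}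
    (hc : IsReversorCover ω A K π σ) :
    ∀ x ∈ ω.orthogonal π.range, K x ∈ ω.orthogonal π.range := by
  rintro x hx _ ⟨m, rfl⟩
  obtain ⟨m', hm', -⟩ := hc.map_K m
  change ω (π m) _ = 0
  rw [← neg_eq_zero, ← h.skewAdj, hm']
  exact hx _ ⟨m', rfl⟩

/-- A reversor on the image of a cover and one on its orthogonal complement glue. -/
theorem IsSkewRoot.exists_isReversor_of_orthogonal [FiniteDimensional F V]
    (h : IsSkewRoot ω A K d) {π : M →ₗ[F] V} {σ : M →ₗ[F] M} (hc : IsReversorCover ω A K π σ)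
    {T : Module.End F (ω.orthogonal π.range)}
    (hT : IsReversor (ω.restrict (ω.orthogonal π.range))
      (A.restrict (h.map_A_orthogonal hc)) (K.restrict (h.map_K_orthogonal hc)) T) :
    ∃ S, IsReversor ω A K S := by
  have hcompl : IsCompl π.range (ω.orthogonal π.range) :=
    (LinearMap.BilinForm.isCompl_orthogonal_iff_disjoint h.alt.isRefl).2
      (hc.disjoint_orthogonal h.alt)
  obtain ⟨g, hg⟩ := π.rangeRestrict.exists_rightInverse_of_surjective π.range_rangeRestrict
  have hπg : ∀ w, π (g w) = w := fun w => congrArg Subtype.val (LinearMap.congr_fun hg w)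
  have hker : ∀ m, π m = 0 → π (σ m) = 0 := fun m hm => hc.radical _ fun n => by
    rw [← hc.invol n, hc.anti, hm, map_zero, LinearMap.zero_apply, neg_zero]
  let S : Module.End F V :=
    LinearMap.ofIsCompl hcompl (π ∘ₗ σ ∘ₗ g) ((ω.orthogonal π.range).subtype ∘ₗ T)
  have hS₁ : ∀ m, S (π m) = π (σ m) := by
    intro m
    have h1 : S (π m) = π (σ (g ⟨π m, m, rfl⟩)) :=
      LinearMap.ofIsCompl_apply_left hcompl (⟨π m, m, rfl⟩ : π.range)
    rw [h1, ← sub_eq_zero, ← map_sub, ← map_sub]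
    apply hker
    rw [map_sub, hπg, sub_self]
  have hS₂ : ∀ t : ω.orthogonal π.range, S t = T t := fun t =>
    LinearMap.ofIsCompl_apply_right hcompl t
  have hdec : ∀ x, ∃ m, ∃ t : ω.orthogonal π.range, x = π m + t := by
    intro x
    obtain ⟨⟨_, m, rfl⟩, t, hx, -⟩ := Submodule.existsUnique_add_of_isCompl hcompl x
    exact ⟨m, t, hx.symm⟩
  have horth : ∀ m (t : ω.orthogonal π.range), ω (π m) t = 0 := fun m t => t.2 _ ⟨m, rfl⟩
  have horth' : ∀ m (t : ω.orthogonal π.range), ω t (π m) = 0 := fun m t => by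
    rw [← h.alt.neg_eq, horth, neg_zero]
  refine ⟨S, ?_, ?_, ?_, ?_⟩
  · intro x
    obtain ⟨m, t, rfl⟩ := hdec x
    rw [map_add, map_add, hS₁, hS₁, hS₂, hS₂, hc.invol, hT.invol]
  · intro x y
    obtain ⟨m, t, rfl⟩ := hdec x
    obtain ⟨n, s, rfl⟩ := hdec y
    have hts : ω (T t : V) (T s) = -ω (t : V) s := hT.anti t s
    simp only [map_add, hS₁, hS₂, LinearMap.add_apply, horth, horth', hc.anti, hts]
    ring
  · intro x
    obtain ⟨m, t, rfl⟩ := hdec x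
    obtain ⟨m', h1, h2⟩ := hc.map_A m
    have ht : A t = (A.restrict (h.map_A_orthogonal hc) t : V) := rfl
    have hTt : A (T t) = (A.restrict (h.map_A_orthogonal hc) (T t) : V) := rfl
    rw [map_add A, map_add S, map_add S, map_add A, h1, hS₁, hS₁, h2, hS₂, ht, hS₂, hTt, hT.comm]
  · intro x
    obtain ⟨m, t, rfl⟩ := hdec x
    obtain ⟨m', h1, h2⟩ := hc.map_K m
    have ht : K t = (K.restrict (h.map_K_orthogonal hc) t : V) := rfl
    have hTt : K (T t) = (K.restrict (h.map_K_orthogonal hc) (T t) : V) := rfl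
    rw [map_add K, map_add S, map_add S, map_add K, h1, hS₁, hS₁, h2, hS₂, ht, hS₂, hTt,
      hT.anticomm, Submodule.coe_neg]
    abel

end Extension

section Covers

variable {F V : Type*} [Field F] [AddCommGroup V] [Module F V]
  {ω : LinearMap.BilinForm F V} {A K : Module.End F V} {d : F[X]}

/-- The involution `(p, q) ↦ (p, -q)`. -/
noncomputable def conjPair (F : Type*) [Field F] : F[X] × F[X] →ₗ[F] F[X] × F[X] :=
  LinearMap.id.prodMap (-LinearMap.id)

theorem conjPair_apply (m : F[X] × F[X]) : conjPair F m = (m.1, -m.2) := rfl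

namespace IsSkewRoot

theorem form_cyclicMap_self [NeZero (2 : F)] (h : IsSkewRoot ω A K d) (x : V) (m n : F[X] × F[X]) :
    ω (cyclicMap A K x m) (cyclicMap A K x n) =
      ω (aeval A (m.2 * n.1 - m.1 * n.2) (K x)) x := by
  rw [h.form_cyclicMap, h.form_aeval_self, zero_add]

theorem form_cyclicMap_conjPair_self [NeZero (2 : F)] (h : IsSkewRoot ω A K d) (x : V) (m n : F[X] × F[X]) :
    ω (cyclicMap A K x (conjPair F m)) (cyclicMap A K x (conjPair F n)) =
      -ω (cyclicMap A K x m) (cyclicMap A K x n) := by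
  rw [h.form_cyclicMap_self, h.form_cyclicMap_self, ← LinearMap.neg_apply, ← map_neg,
    ← LinearMap.neg_apply, ← map_neg]
  simp only [conjPair_apply]
  ring_nf

theorem map_K_cyclicMap_conjPair (h : IsSkewRoot ω A K d) (x : V) (m : F[X] × F[X]) :
    K (cyclicMap A K x (conjPair F m)) = -cyclicMap A K x (conjPair F (m.2 * d, m.1)) := by
  rw [h.map_K_cyclicMap, ← map_neg]
  simp [conjPair_apply]

/-- The cyclic subspace of a vector `v` with `ω(r ^ k(A) K v, v) ≠ 0`. -/
theorem isReversorCover_cyclicMap [NeZero (2 : F)] (h : IsSkewRoot ω A K d) {r : F[X]} (hr : Irreducible r)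
    {k : ℕ} {v : V} (hv : aeval A (r ^ (k + 1)) v = 0)
    (hne : ω (aeval A (r ^ k) (K v)) v ≠ 0) :
    IsReversorCover ω A K (cyclicMap A K v) (conjPair F) where
  invol m := by simp [conjPair_apply]
  map_A m := ⟨(X * m.1, X * m.2), map_A_cyclicMap v m, by
    rw [map_A_cyclicMap]
    simp [conjPair_apply]⟩
  map_K m := ⟨(m.2 * d, m.1), h.map_K_cyclicMap v m, h.map_K_cyclicMap_conjPair v m⟩
  anti := h.form_cyclicMap_conjPair_self v
  radical m hm := by
    simp only [h.form_cyclicMap_self] at hm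
    have hKv : aeval A (r ^ (k + 1)) (K v) = 0 := by rw [← h.comm_aeval, hv, map_zero]
    have h2 : r ^ (k + 1) ∣ m.2 := pow_dvd_of_form_eq_zero hr hKv hne fun z => by
      simpa using hm (z, 0)
    have h1 : r ^ (k + 1) ∣ m.1 := pow_dvd_of_form_eq_zero hr hKv hne fun z => by
      simpa using hm (0, z)
    rw [cyclicMap_apply, aeval_apply_eq_zero_of_dvd h1 hv, aeval_apply_eq_zero_of_dvd h2 hKv,
      add_zero]

/-- The sum of two cyclic subspaces in the case where `r ^ k(A) K` vanishes on both of them. -/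
theorem isReversorCover_coprod_cyclicMap [NeZero (2 : F)] (h : IsSkewRoot ω A K d) (hd : Squarefree d) {r : F[X]}
    (hr : Irreducible r) (hrd : r ∣ d) {k : ℕ} {u w : V} (hu : aeval A (r ^ (k + 1)) u = 0)
    (hw : aeval A (r ^ (k + 1)) w = 0) (hKu : aeval A (r ^ k) (K u) = 0)
    (hKw : aeval A (r ^ k) (K w) = 0) (hne : ω (aeval A (r ^ k) u) w ≠ 0)
    (horth : ∀ z : F[X], ω (aeval A z (K u)) w = 0) :
    IsReversorCover ω A K ((cyclicMap A K u).coprod (cyclicMap A K w))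
      ((conjPair F).prodMap (-conjPair F)) where
  invol m := by simp [conjPair_apply]
  map_A m := ⟨((X * m.1.1, X * m.1.2), (X * m.2.1, X * m.2.2)), by
    simp [map_A_cyclicMap], by simp [map_A_cyclicMap, conjPair_apply]⟩
  map_K m := ⟨((m.1.2 * d, m.1.1), (m.2.2 * d, m.2.1)), by
    simp [h.map_K_cyclicMap], by
      simp only [LinearMap.coprod_apply, LinearMap.prodMap_apply, LinearMap.neg_apply, map_add,
        map_neg, h.map_K_cyclicMap_conjPair]
      abel⟩
  anti m n := by
    have huw : ∀ m n, ω (cyclicMap A K u m) (cyclicMap A K w n) =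
        ω (aeval A (m.1 * n.1 - m.2 * n.2 * d) u) w := by
      intro m n
      rw [h.form_cyclicMap, horth, add_zero]
    have hwu : ∀ m n, ω (cyclicMap A K w m) (cyclicMap A K u n) =
        ω (aeval A (m.1 * n.1 - m.2 * n.2 * d) w) u := by
      intro m n
      rw [h.form_cyclicMap, h.form_aeval_skew_swap, horth, add_zero]
    simp only [LinearMap.coprod_apply, LinearMap.prodMap_apply, LinearMap.neg_apply, map_add,
      map_neg, LinearMap.add_apply, h.form_cyclicMap_conjPair_self, huw, hwu]
    simp only [conjPair_apply, neg_mul_neg]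
    ring
  radical m hm := by
    obtain ⟨⟨a, b⟩, ⟨a', b'⟩⟩ := m
    simp only [LinearMap.coprod_apply, map_add, LinearMap.add_apply, Prod.forall] at hm
    have hmw := fun n₁ n₂ => hm 0 0 n₁ n₂
    have hmu := fun n₁ n₂ => hm n₁ n₂ 0 0
    simp only [Prod.mk_zero_zero, map_zero, add_zero, zero_add, h.form_cyclicMap_self] at hmw hmu
    simp only [h.form_cyclicMap, horth, h.form_aeval_skew_swap _ w u, add_zero,
      h.form_aeval_swap _ w u] at hmw hmu
    have hμ : ∀ f, (∀ z, formFunctional ω A u w (f * z) = 0) → r ^ (k + 1) ∣ f :=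
      fun f hf => pow_dvd_of_form_eq_zero hr hu hne hf
    have hα : ∀ z, r ^ k ∣ z → formFunctional ω A (K u) u z = 0 := fun z hz => by
      rw [formFunctional_apply, aeval_apply_eq_zero_of_dvd hz hKu, map_zero,
        LinearMap.zero_apply]
    have hβ : ∀ z, r ^ k ∣ z → (-formFunctional ω A (K w) w) z = 0 := fun z hz => by
      rw [LinearMap.neg_apply, formFunctional_apply, aeval_apply_eq_zero_of_dvd hz hKw, map_zero,
        LinearMap.zero_apply, neg_zero]
    obtain ⟨ha, hb'⟩ := pow_dvd_of_coupled hr hd hrd (formFunctional ω A u w)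
      (formFunctional ω A (K u) u) (-formFunctional ω A (K w) w) hμ hα hβ (a := a) (b := b')
      (fun z => by
        have := hmw z 0
        simp only [mul_zero, zero_mul, sub_zero] at this
        simpa [formFunctional_apply] using eq_neg_of_add_eq_zero_left this)
      (fun z => by
        have := hmu 0 z
        simp only [mul_zero, zero_sub, map_neg, LinearMap.neg_apply, neg_neg] at this
        rw [formFunctional_apply, formFunctional_apply, mul_right_comm]
        linear_combination this)
    obtain ⟨ha', hb⟩ := pow_dvd_of_coupled hr hd hrd (formFunctional ω A u w)
      (-formFunctional ω A (K w) w) (formFunctional ω A (K u) u) hμ hβ hα (a := a') (b := b)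
      (fun z => by
        have := hmu z 0
        simp only [mul_zero, zero_mul, sub_zero] at this
        rw [formFunctional_apply, formFunctional_apply]
        linear_combination -this)
      (fun z => by
        have := hmw 0 z
        simp only [mul_zero, zero_sub, map_neg, LinearMap.neg_apply] at this
        rw [LinearMap.neg_apply, formFunctional_apply, formFunctional_apply, mul_right_comm]
        linear_combination -this)
    simp only [LinearMap.coprod_apply, cyclicMap_apply, aeval_apply_eq_zero_of_dvd ha hu,
      aeval_apply_eq_zero_of_dvd hb hKu, aeval_apply_eq_zero_of_dvd ha' hw,
      aeval_apply_eq_zero_of_dvd hb' hKw, add_zero]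

end IsSkewRoot

end Covers

section Existence

variable {F V : Type*} [Field F] [AddCommGroup V] [Module F V]
  {ω : LinearMap.BilinForm F V} {A K : Module.End F V} {d : F[X]}

/-- An irreducible factor `r` of the minimal polynomial, its multiplicity `k + 1`, and a polynomial
`q` for which `q(A)` projects onto the `r`-primary component. -/
theorem exists_primary_projection [FiniteDimensional F V] [Nontrivial V] (A : Module.End F V) :
    ∃ (r q : F[X]) (k : ℕ), Irreducible r ∧ (∀ x, aeval A (r ^ (k + 1)) (aeval A q x) = 0) ∧
      (∀ x, aeval A (r ^ (k + 1)) x = 0 → aeval A q x = x) ∧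
      ∃ x, aeval A (r ^ (k + 1)) x = 0 ∧ aeval A (r ^ k) x ≠ 0 := by
  have hint : IsIntegral F A := Algebra.IsIntegral.isIntegral A
  obtain ⟨r, hr, hrm⟩ := WfDvdMonoid.exists_irreducible_factor (minpoly.not_isUnit F A)
    (minpoly.ne_zero hint)
  obtain ⟨s, hs, hrs⟩ := (FiniteMultiplicity.of_not_isUnit hr.not_isUnit
    (minpoly.ne_zero hint)).exists_eq_pow_mul_and_not_dvd
  obtain ⟨k, hk⟩ : ∃ k, multiplicity r (minpoly F A) = k + 1 := by
    refine Nat.exists_eq_succ_of_ne_zero fun h0 => hrs ?_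
    rw [h0, pow_zero, one_mul] at hs
    rwa [← hs]
  rw [hk] at hs
  have hann : ∀ x, aeval A (r ^ (k + 1)) (aeval A s x) = 0 := fun x => by
    rw [← aeval_mul_apply, ← hs, minpoly.aeval, LinearMap.zero_apply]
  obtain ⟨a, b, hab⟩ : IsCoprime (r ^ (k + 1)) s :=
    ((hr.coprime_iff_not_dvd).2 hrs).pow_left
  refine ⟨r, s * b, k, hr, fun x => ?_, fun x hx => ?_, ?_⟩
  · rw [aeval_mul_apply, hann]
  · have h1 : aeval A (a * r ^ (k + 1) + b * s) x = x := by rw [hab, map_one, Module.End.one_apply]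
    rwa [map_add, LinearMap.add_apply, aeval_mul_apply, hx, map_zero, zero_add, mul_comm] at h1
  · by_contra! hcon
    have h0 : aeval A (r ^ k * s) = 0 := LinearMap.ext fun x => by
      rw [aeval_mul_apply, hcon _ (hann x), LinearMap.zero_apply]
    have hdvd := minpoly.dvd F A h0
    have hs0 : s ≠ 0 := fun h => minpoly.ne_zero hint (by rw [hs, h, mul_zero])
    rw [hs, mul_dvd_mul_iff_right hs0, pow_dvd_pow_iff hr.ne_zero hr.not_isUnit] at hdvd
    omega

/-- A vector that pairs with `r ^ k(A) u` but not with `F[A] K u`. -/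
theorem exists_orthogonal_skew [FiniteDimensional F V] (hω : ω.Nondegenerate) {c : F[X]} {u : V}
    (hu : ∀ z : F[X], aeval A z (K u) ≠ aeval A c u) :
    ∃ w, ω (aeval A c u) w ≠ 0 ∧ ∀ z : F[X], ω (aeval A z (K u)) w = 0 := by
  let Z : Submodule F V := LinearMap.range ((LinearMap.applyₗ (K u)).comp (aeval A).toLinearMap)
  have hmem : aeval A c u ∉ Z := by
    rintro ⟨z, hz⟩
    exact hu z hz
  obtain ⟨f, hf, hZ⟩ := Submodule.exists_le_ker_of_notMem hmem
  have hfl : ω.flip.Nondegenerate := LinearMap.flip_nondegenerate.2 hω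
  have hrep : ∀ x, ω x ((LinearMap.BilinForm.toDual ω.flip hfl).symm f) = f x := fun x =>
    LinearMap.congr_fun ((LinearMap.BilinForm.toDual ω.flip hfl).apply_symm_apply f) x
  refine ⟨(LinearMap.BilinForm.toDual ω.flip hfl).symm f, by rwa [hrep], fun z => ?_⟩
  rw [hrep]
  exact hZ ⟨z, rfl⟩

namespace IsSkewRoot

/-- In the primary component, a symmetric form `ω(r ^ k(A) K x, y)` that does not vanish is
anisotropic on some vector. -/
theorem exists_form_skew_ne_zero [NeZero (2 : F)] (h : IsSkewRoot ω A K d)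
    (hω : ω.Nondegenerate) {p q c : F[X]} (hq : ∀ x, aeval A p (aeval A q x) = 0)
    (hq' : ∀ x, aeval A p x = 0 → aeval A q x = x) {x : V} (hx : aeval A p x = 0)
    (hne : aeval A c (K x) ≠ 0) :
    ∃ v, aeval A p v = 0 ∧ ω (aeval A c (K v)) v ≠ 0 := by
  obtain ⟨y, hy⟩ : ∃ y, ω (aeval A c (K x)) y ≠ 0 := by
    by_contra! hcon
    exact hne (hω.1 _ hcon)
  have hfix : aeval A q (aeval A c (K x)) = aeval A c (K x) := by
    rw [← aeval_mul_apply, mul_comm, aeval_mul_apply, ← h.comm_aeval q, hq' x hx]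
  rw [← hfix, h.aeval_selfAdj] at hy
  by_contra! hcon
  have h1 := hcon x hx
  have h2 := hcon _ (hq y)
  have h3 := hcon (x + aeval A q y) (by rw [map_add, hx, hq, add_zero])
  simp only [map_add, LinearMap.add_apply, h1, h2, h.form_aeval_skew_swap c (aeval A q y) x,
    zero_add, add_zero] at h3
  rw [← two_mul] at h3
  exact hy ((mul_eq_zero.1 h3).resolve_left two_ne_zero)

/-- If `r ^ k(A) K` vanishes on the `r`-primary component, then `r` divides `d`. -/
theorem dvd_of_skew_eq_zero (h : IsSkewRoot ω A K d) {r : F[X]} (hr : Irreducible r) {k : ℕ}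
    {u : V} (hu : aeval A (r ^ (k + 1)) u = 0) (hu' : aeval A (r ^ k) u ≠ 0)
    (hKu : aeval A (r ^ k) (K u) = 0) : r ∣ d := by
  by_contra hrd
  obtain ⟨a, b, hab⟩ := (hr.coprime_iff_not_dvd).2 hrd
  have hdu : aeval A (d * r ^ k) u = 0 := by
    rw [mul_comm, aeval_mul_apply, ← h.sq, ← h.comm_aeval, hKu, map_zero]
  apply hu'
  have : r ^ k = a * r ^ (k + 1) + b * (d * r ^ k) := by linear_combination (-r ^ k) * hab
  rw [this, map_add, LinearMap.add_apply, aeval_mul_apply, hu, aeval_mul_apply, hdu, map_zero,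
    map_zero, add_zero]

theorem aeval_eq_zero_of_eq_pow (h : IsSkewRoot ω A K d) (hd : Squarefree d) {r : F[X]}
    (hr : Irreducible r) {k : ℕ} {u : V} (hu : aeval A (r ^ (k + 1)) u = 0)
    (hKu : aeval A (r ^ k) (K u) = 0) {z : F[X]} (hz : aeval A z (K u) = aeval A (r ^ k) u) :
    aeval A (r ^ k) u = 0 := by
  by_contra hu'
  obtain ⟨e, rfl⟩ := h.dvd_of_skew_eq_zero hr hu hu' hKu
  have hre : ¬ r ∣ e := by
    rintro ⟨e', rfl⟩
    exact hr.not_isUnit (hd r ⟨e', by ring⟩)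
  have hzd : aeval A (z * (r * e)) u = 0 := by
    rw [aeval_mul_apply, ← h.sq, ← h.comm_aeval, hz, h.comm_aeval, hKu]
  have hdvd : r ^ (k + 1) ∣ z * (r * e) := by
    by_contra hn
    obtain ⟨g, q, hgq⟩ := exists_mul_add_eq_pow_of_not_pow_dvd hr hn
    apply hu'
    rw [← hgq, map_add, LinearMap.add_apply, aeval_apply_eq_zero_of_dvd (dvd_mul_right _ g) hzd,
      aeval_apply_eq_zero_of_dvd (dvd_mul_right _ q) hu, add_zero]
  rw [pow_succ, show z * (r * e) = (z * e) * r by ring, mul_dvd_mul_iff_right hr.ne_zero] at hdvd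
  apply hu'
  rw [← hz]
  exact aeval_apply_eq_zero_of_dvd (hr.prime.pow_dvd_of_dvd_mul_right _ hre hdvd) hKu

theorem exists_isReversorCover [NeZero (2 : F)] [FiniteDimensional F V] [Nontrivial V]
    (h : IsSkewRoot ω A K d) (hω : ω.Nondegenerate) (hd : Squarefree d) :
    (∃ v, v ≠ 0 ∧ IsReversorCover ω A K (cyclicMap A K v) (conjPair F)) ∨
      ∃ u w, u ≠ 0 ∧ IsReversorCover ω A K ((cyclicMap A K u).coprod (cyclicMap A K w))
        ((conjPair F).prodMap (-conjPair F)) := by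
  obtain ⟨r, q, k, hr, hq, hq', u, hu, hu'⟩ := exists_primary_projection A
  by_cases hK : ∀ x, aeval A (r ^ (k + 1)) x = 0 → aeval A (r ^ k) (K x) = 0
  · right
    obtain ⟨w, hw, hZ⟩ := exists_orthogonal_skew hω (c := r ^ k) (u := u) fun z hz =>
      hu' (h.aeval_eq_zero_of_eq_pow hd hr hu (hK u hu) hz)
    have hcomm : ∀ (p : F[X]) (x : V), aeval A q (aeval A p x) = aeval A p (aeval A q x) := by
      intro p x
      rw [← aeval_mul_apply, mul_comm, aeval_mul_apply]
    refine ⟨u, aeval A q w, ?_, h.isReversorCover_coprod_cyclicMap hd hr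
      (h.dvd_of_skew_eq_zero hr hu hu' (hK u hu)) hu (hq w) (hK u hu) (hK _ (hq w)) ?_ ?_⟩
    · rintro rfl
      exact hu' (map_zero _)
    · rwa [← h.aeval_selfAdj, hcomm, hq' u hu]
    · intro z
      rw [← h.aeval_selfAdj, ← aeval_mul_apply]
      exact hZ _
  · left
    push Not at hK
    obtain ⟨x, hx, hxK⟩ := hK
    obtain ⟨v, hv, hvK⟩ := h.exists_form_skew_ne_zero hω hq hq' hx hxK
    refine ⟨v, ?_, h.isReversorCover_cyclicMap hr hv hvK⟩
    rintro rfl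
    exact hvK (map_zero _)

end IsSkewRoot

theorem cyclicMap_one_zero (x : V) : cyclicMap A K x (1, 0) = x := by
  simp [cyclicMap_apply]

end Existence

/-- A self-adjoint and a skew-adjoint endomorphism with `K ^ 2 = d(A)`, `d` squarefree, of a
symplectic space have a common reversor. -/
theorem IsSkewRoot.exists_isReversor {F V : Type*} [Field F] [NeZero (2 : F)] [AddCommGroup V]
    [Module F V] [FiniteDimensional F V] {ω : LinearMap.BilinForm F V} {A K : Module.End F V}
    {d : F[X]} (h : IsSkewRoot ω A K d) (hω : ω.Nondegenerate) (hd : Squarefree d) :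
    ∃ S, IsReversor ω A K S := by
  induction hn : Module.finrank F V using Nat.strong_induction_on generalizing V with
  | _ n ih =>
    have descend : ∀ {M : Type _} [AddCommGroup M] [Module F M] {π : M →ₗ[F] V} {σ : M →ₗ[F] M},
        IsReversorCover ω A K π σ → (∃ m, π m ≠ 0) → ∃ S, IsReversor ω A K S := by
      intro M _ _ π σ hc ⟨m, hm⟩
      have hdisj := hc.disjoint_orthogonal h.alt
      have hne : ω.orthogonal π.range ≠ ⊤ := by
        intro htop
        rw [htop, disjoint_top] at hdisj
        exact hm ((Submodule.mem_bot F).1 (hdisj ▸ ⟨m, rfl⟩))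
      obtain ⟨T, hT⟩ := ih _ (hn ▸ Submodule.finrank_lt hne.lt_top.ne)
        (h.restrict (h.map_A_orthogonal hc) (h.map_K_orthogonal hc))
        (ω.nondegenerate_restrict_of_disjoint_orthogonal h.alt.isRefl
          (by rw [ω.orthogonal_orthogonal hω h.alt.isRefl]; exact hdisj.symm)) rfl
      exact h.exists_isReversor_of_orthogonal hc hT
    rcases subsingleton_or_nontrivial V with hV | hV
    · exact ⟨1, fun _ => rfl, fun x y => by simp [Subsingleton.elim x 0], fun _ => rfl,
        fun _ => Subsingleton.elim _ _⟩
    · rcases h.exists_isReversorCover hω hd with ⟨v, hv, hc⟩ | ⟨u, w, hu, hc⟩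
      · exact descend hc ⟨(1, 0), by rwa [cyclicMap_one_zero]⟩
      · exact descend hc ⟨((1, 0), 0), by
          rwa [LinearMap.coprod_apply, map_zero, add_zero, cyclicMap_one_zero]⟩

section AntisymplecticInvolution

variable {F V : Type*} [Field F] [NeZero (2 : F)] [AddCommGroup V] [Module F V]
  [FiniteDimensional F V] {ω : LinearMap.BilinForm F V}

theorem squarefree_X_sq_sub_four : Squarefree (X ^ 2 - C 4 : F[X]) := by
  have h2 : (2 : F) ≠ 0 := NeZero.ne 2
  refine Polynomial.Separable.squarefree ⟨-C (4⁻¹), C (8⁻¹) * X, ?_⟩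
  have h4 : (4 : F) ≠ 0 := by
    rw [show (4 : F) = 2 * 2 by norm_num]
    exact mul_ne_zero h2 h2
  have e1 : C (8⁻¹ : F) * C 2 = C (4⁻¹ : F) := by
    rw [← C_mul, show (8 : F) = 4 * 2 by norm_num, mul_inv, mul_assoc,
      inv_mul_cancel₀ h2, mul_one]
  have e2 : C (4⁻¹ : F) * C 4 = 1 := by rw [← C_mul, inv_mul_cancel₀ h4, C_1]
  simp only [derivative_sub, derivative_X_pow, derivative_C]
  norm_num
  linear_combination (X ^ 2) * e1 + e2

/-- Every symplectic automorphism is conjugated to its inverse by an antisymplectic involution. -/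
theorem exists_antisymplectic_involution_conj (halt : ω.IsAlt) (hω : ω.Nondegenerate)
    (φ : V ≃ₗ[F] V) (hφ : ∀ x y, ω (φ x) (φ y) = ω x y) :
    ∃ S : Module.End F V, (∀ x, S (S x) = x) ∧ (∀ x y, ω (S x) (S y) = -ω x y) ∧
      ∀ x, S (φ x) = φ.symm (S x) := by
  have h2 : (2 : F) ≠ 0 := NeZero.ne 2
  have hl : ∀ x y, ω (φ x) y = ω x (φ.symm y) := fun x y => by
    rw [← hφ x (φ.symm y), φ.apply_symm_apply]
  have hr : ∀ x y, ω (φ.symm x) y = ω x (φ y) := fun x y => by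
    rw [← hφ (φ.symm x) y, φ.apply_symm_apply]
  have h : IsSkewRoot ω ((φ : V →ₗ[F] V) + φ.symm) ((φ : V →ₗ[F] V) - φ.symm) (X ^ 2 - C 4) :=
    { alt := halt
      selfAdj := fun x y => by simp [hl, hr, add_comm]
      skewAdj := fun x y => by simp [hl, hr]
      comm := fun x => by
        simp only [LinearMap.add_apply, LinearMap.sub_apply, LinearEquiv.coe_coe, map_add,
          map_sub, LinearEquiv.apply_symm_apply, LinearEquiv.symm_apply_apply]
        abel
      sq := fun x => by
        simp only [map_sub, map_mul, aeval_X, aeval_C, LinearMap.sub_apply, pow_two,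
          Module.End.mul_apply, LinearMap.add_apply, LinearEquiv.coe_coe, map_add,
          LinearEquiv.apply_symm_apply, LinearEquiv.symm_apply_apply,
          Module.algebraMap_end_apply]
        module }
  obtain ⟨S, hS⟩ := h.exists_isReversor hω squarefree_X_sq_sub_four
  refine ⟨S, hS.invol, hS.anti, fun x => ?_⟩
  have h1 := hS.comm x
  have h2' := hS.anticomm x
  simp only [LinearMap.add_apply, LinearMap.sub_apply, LinearEquiv.coe_coe, map_add, map_sub]
    at h1 h2'
  have h3 : (2 : F) • S (φ x) = (2 : F) • φ.symm (S x) := by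
    calc (2 : F) • S (φ x) = (S (φ x) + S (φ.symm x)) + (S (φ x) - S (φ.symm x)) := by module
      _ = _ := by rw [h1, h2']; module
  exact smul_right_injective V h2 h3

/-- A symplectic basis adapted to an antisymplectic involution. -/
theorem exists_symplectic_basis_of_antisymplectic_involution
    (hω : ω.Nondegenerate) {n : ℕ} (hn : Module.finrank F V = n + n) {S : Module.End F V}
    (hS : ∀ x, S (S x) = x) (hanti : ∀ x y, ω (S x) (S y) = -ω x y) :
    ∃ e f : Fin n → V, (∀ i, S (e i) = e i) ∧ (∀ i, S (f i) = -f i) ∧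
      (∀ i j, ω (e i) (e j) = 0) ∧ (∀ i j, ω (f i) (f j) = 0) ∧
      ∀ i j, ω (f i) (e j) = if i = j then 1 else 0 := by
  have h2 : (2 : F) ≠ 0 := NeZero.ne 2
  have self_neg : ∀ a : F, a = -a → a = 0 := fun a ha => by
    have : (2 : F) * a = 0 := by linear_combination ha
    exact (mul_eq_zero.1 this).resolve_left h2
  let L : Submodule F V := LinearMap.ker (S - 1)
  let L' : Submodule F V := LinearMap.ker (S + 1)
  have hL : ∀ x, x ∈ L ↔ S x = x := fun x => by
    simp [L, sub_eq_zero]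
  have hL' : ∀ x, x ∈ L' ↔ S x = -x := fun x => by
    simp [L', add_eq_zero_iff_eq_neg]
  have isoL : ∀ x ∈ L, ∀ y ∈ L, ω x y = 0 := fun x hx y hy => self_neg _ <| by
    conv_lhs => rw [← neg_neg (ω x y), ← hanti, (hL x).1 hx, (hL y).1 hy]
  have isoL' : ∀ x ∈ L', ∀ y ∈ L', ω x y = 0 := fun x hx y hy => self_neg _ <| by
    conv_lhs => rw [← neg_neg (ω x y), ← hanti, (hL' x).1 hx, (hL' y).1 hy]
    simp
  have hdec : ∀ x, ∃ y ∈ L, ∃ z ∈ L', y + z = x := fun x => by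
    refine ⟨(2⁻¹ : F) • (x + S x), (hL _).2 ?_, (2⁻¹ : F) • (x - S x), (hL' _).2 ?_, ?_⟩
    · rw [map_smul, map_add, hS, add_comm]
    · rw [map_smul, map_sub, hS]
      module
    · rw [← smul_add, add_add_sub_cancel, ← two_smul F x, smul_smul, inv_mul_cancel₀ h2, one_smul]
  have hcompl : IsCompl L L' := by
    refine ⟨Submodule.disjoint_def.2 fun x hx hx' => ?_, codisjoint_iff.2 (eq_top_iff.2 ?_)⟩
    · have : (2 : F) • x = 0 := by
        rw [two_smul]
        nth_rewrite 1 [← (hL x).1 hx]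
        rw [(hL' x).1 hx', neg_add_cancel]
      exact (smul_eq_zero.1 this).resolve_left h2
    · intro x _
      obtain ⟨y, hy, z, hz, hx⟩ := hdec x
      exact Submodule.mem_sup.2 ⟨y, hy, z, hz, hx⟩
  let B : L →ₗ[F] Module.Dual F L' := ω.domRestrict₁₂ L L'
  let B' : L' →ₗ[F] Module.Dual F L := ω.domRestrict₁₂ L' L
  have hB : Function.Injective B := (injective_iff_map_eq_zero B).2 fun x hx =>
    Subtype.ext <| hω.1 _ fun y => by
      obtain ⟨y, hy, z, hz, rfl⟩ := hdec y
      rw [map_add, isoL _ x.2 _ hy, zero_add]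
      exact LinearMap.congr_fun hx ⟨z, hz⟩
  have hB' : Function.Injective B' := (injective_iff_map_eq_zero B').2 fun x hx =>
    Subtype.ext <| hω.1 _ fun y => by
      obtain ⟨y, hy, z, hz, rfl⟩ := hdec y
      rw [map_add, isoL' _ x.2 _ hz, add_zero]
      exact LinearMap.congr_fun hx ⟨y, hy⟩
  have h1 := LinearMap.finrank_le_finrank_of_injective hB
  have h1' := LinearMap.finrank_le_finrank_of_injective hB'
  rw [Subspace.dual_finrank_eq] at h1 h1'
  have hsum := Submodule.finrank_add_eq_of_isCompl hcompl
  have hLn : Module.finrank F L = n := by omega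
  let b := Module.finBasisOfFinrankEq F L hLn
  let E := B'.linearEquivOfInjective hB' (by rw [Subspace.dual_finrank_eq]; omega)
  refine ⟨fun i => b i, fun i => E.symm (b.dualBasis i), fun i => (hL _).1 (b i).2,
    fun i => (hL' _).1 (E.symm (b.dualBasis i)).2, fun i j => isoL _ (b i).2 _ (b j).2,
    fun i j => isoL' _ (E.symm _).2 _ (E.symm _).2, fun i j => ?_⟩
  have : ω (E.symm (b.dualBasis i) : V) (b j : V) = b.dualBasis i (b j) :=
    LinearMap.congr_fun (E.apply_symm_apply (b.dualBasis i)) (b j)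
  rw [this, b.dualBasis_apply_self]
  simp [eq_comm]

end AntisymplecticInvolution

theorem toBilin'_J_isAlt (n : ℕ) : (Matrix.toBilin' (J (Fin n) ℝ)).IsAlt := fun v => by
  rw [Matrix.toBilin'_apply', ← neg_eq_zero, ← stdSymplecticForm_eq]
  simp [stdSymplecticForm, mul_comm]

theorem toBilin'_J_nondegenerate (n : ℕ) : (Matrix.toBilin' (J (Fin n) ℝ)).Nondegenerate :=
  LinearMap.BilinForm.nondegenerate_toBilin'_iff_det_ne_zero.2 (isUnit_det_J (Fin n) ℝ).ne_zero

/-- Every antisymplectic involution of `ℝ²ⁿ` is symplectically conjugate to the standard one. -/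
theorem exists_symplectic_mul_antisymplecticR {n : ℕ}
    {S : Module.End ℝ (Fin n ⊕ Fin n → ℝ)} (hS : ∀ x, S (S x) = x)
    (hanti : ∀ x y, Matrix.toBilin' (J (Fin n) ℝ) (S x) (S y) =
      -Matrix.toBilin' (J (Fin n) ℝ) x y) :
    ∃ P : symplecticGroup (Fin n) ℝ,
      LinearMap.toMatrix' S * (P : Matrix (Fin n ⊕ Fin n) (Fin n ⊕ Fin n) ℝ) =
        P * antiSymplecticR n := by
  obtain ⟨e, f, he, hf, hee, hff, hfe⟩ := exists_symplectic_basis_of_antisymplectic_involution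
    (toBilin'_J_nondegenerate n) (n := n) (by simp) hS hanti
  have hef : ∀ i j, Matrix.toBilin' (J (Fin n) ℝ) (e i) (f j) = -if i = j then 1 else 0 :=
    fun i j => by rw [← (toBilin'_J_isAlt n).neg_eq, hfe]; simp [eq_comm]
  let P : Matrix (Fin n ⊕ Fin n) (Fin n ⊕ Fin n) ℝ := (Matrix.of (Sum.elim e f))ᵀ
  have hcol : ∀ j, P *ᵥ Pi.single j 1 = Sum.elim e f j := fun j => by
    rw [mulVec_single_one]
    rfl
  have hP : P ∈ symplecticGroup (Fin n) ℝ := by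
    rw [SymplecticGroup.mem_iff']
    ext i j
    have : (Pᵀ * J (Fin n) ℝ * P) i j =
        Matrix.toBilin' (J (Fin n) ℝ) (Sum.elim e f i) (Sum.elim e f j) := by
      rw [Matrix.toBilin'_apply', dotProduct_mulVec]
      rfl
    rw [this]
    rcases i with i | i <;> rcases j with j | j <;>
      simp only [Sum.elim_inl, Sum.elim_inr, hee, hff, hfe, hef] <;>
      simp [J, Matrix.one_apply]
  refine ⟨⟨P, hP⟩, ?_⟩
  apply Matrix.ext_of_mulVec_single
  intro j
  rw [← mulVec_mulVec, ← mulVec_mulVec, hcol, LinearMap.toMatrix'_mulVec]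
  rcases j with j | j
  · have : antiSymplecticR n *ᵥ Pi.single (Sum.inl j) 1 = Pi.single (Sum.inl j) 1 := by
      ext i
      rcases i with i | i <;> simp [antiSymplecticR, Matrix.one_apply, Pi.single_apply]
    rw [this, hcol]
    exact he j
  · have : antiSymplecticR n *ᵥ Pi.single (Sum.inr j) 1 = -Pi.single (Sum.inr j) 1 := by
      ext i
      rcases i with i | i <;> simp [antiSymplecticR, Matrix.one_apply, Pi.single_apply]
    rw [this, mulVec_neg, hcol]
    exact hf j

theorem theorem2 (n : ℕ) (φ : Matrix.symplecticGroup (Fin n) ℝ) :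
    ∃ ψ : Matrix.symplecticGroup (Fin n) ℝ, ψ * φ * ψ⁻¹ ∈ SpR n := by
  have hinv : ∀ ψ : symplecticGroup (Fin n) ℝ,
      (ψ : Matrix (Fin n ⊕ Fin n) (Fin n ⊕ Fin n) ℝ) * (ψ⁻¹ : symplecticGroup (Fin n) ℝ) = 1 :=
    fun ψ => congrArg Subtype.val (mul_inv_cancel ψ)
  have hinv' : ∀ ψ : symplecticGroup (Fin n) ℝ,
      ((ψ⁻¹ : symplecticGroup (Fin n) ℝ) : Matrix (Fin n ⊕ Fin n) (Fin n ⊕ Fin n) ℝ) * ψ = 1 :=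
    fun ψ => congrArg Subtype.val (inv_mul_cancel ψ)
  obtain ⟨S, hS, hanti, hSφ⟩ := exists_antisymplectic_involution_conj (toBilin'_J_isAlt n)
    (toBilin'_J_nondegenerate n)
    (Matrix.toLin'OfInv (hinv' φ) (hinv φ)) (fun x y => by
      have := (mem_symplecticGroup_iff_form n φ).1 φ.2 x y
      rw [stdSymplecticForm_eq, stdSymplecticForm_eq, neg_inj] at this
      rw [Matrix.toBilin'_apply', Matrix.toBilin'_apply']
      exact this)
  obtain ⟨P, hP⟩ := exists_symplectic_mul_antisymplecticR hS hanti
  set M := LinearMap.toMatrix' S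
  have hM : M * φ = (φ⁻¹ : symplecticGroup (Fin n) ℝ) * M := by
    apply Matrix.ext_of_mulVec_single
    intro j
    simp only [M, ← mulVec_mulVec, LinearMap.toMatrix'_mulVec]
    exact hSφ (Pi.single j 1)
  have hMM : M * M = 1 := by
    rw [← LinearMap.toMatrix'_mul, show S * S = 1 from LinearMap.ext hS, LinearMap.toMatrix'_one]
  refine ⟨P⁻¹, ?_⟩
  rw [SpR, Set.mem_ofPred_eq, show (P⁻¹ * φ * P⁻¹⁻¹)⁻¹ = P⁻¹ * φ⁻¹ * P by group, inv_inv]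
  simp only [Submonoid.coe_mul]
  have hR : antiSymplecticR n * (P⁻¹ : symplecticGroup (Fin n) ℝ) =
      (P⁻¹ : symplecticGroup (Fin n) ℝ) * M := by
    calc _ = (P⁻¹ : symplecticGroup (Fin n) ℝ) * (P * antiSymplecticR n) *
          (P⁻¹ : symplecticGroup (Fin n) ℝ) := by rw [← mul_assoc, hinv', one_mul]
      _ = _ := by rw [← hP, ← mul_assoc, mul_assoc, hinv, mul_one]
  have hφ : M * (φ⁻¹ : symplecticGroup (Fin n) ℝ) * M = φ := by
    rw [mul_assoc, ← hM, ← mul_assoc, hMM, one_mul]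
  rw [← mul_assoc, ← mul_assoc, hR, mul_assoc _ P.1, ← hP]
  conv_lhs => rw [← hφ]
  simp only [mul_assoc]
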